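/- Let $\lambda\in(0,1)$ and $d\in(0,1-\lambda)$. Write $\theta_b(z)=0$ if $z<b$ and $\theta_b(z)=1$ if $z\ge b$, and let $\{x\}=x-\lfloor x\rfloor$. For $\delta\in(1-\lambda-d,1)$ and $a\in[0,1]$ let $f=f_{\delta,a}$ be the map of $[0,1)$ given by $f(x)=F(x)\bmod 1$, where $$F(x)=\lambda x+\delta+(1-\lambda)\lfloor x\rfloor+d\,\theta_a(\{x\})\qquad(x\in\mathbb R).$$ Its rotation number $\rho_f\in[0,1)$ is $\lim_{n\to\infty}F^n(x)/n \bmod 1$, a limit which is independent of $x\in\mathbb{R}$. For $\rho,\alpha\in[0,1]$ put $$\delta(\rho,\alpha)=1-\lambda-d+\frac{1-\lambda}{\lambda}\sum_{k\ge1}\lambda^k\bigl((1-\lambda)\lfloor k\rho\rfloor+d\,\theta_{1-\alpha}(\{k\rho\})\bigr),$$ $$a(\delta,\rho,\alpha)=\frac{\delta}{1-\lambda}+\frac1\lambda\sum_{k\ge1}\lambda^k\bigl((1-\lambda)\lfloor\alpha-k\rho\rfloor+d\,\theta_{\alpha}(\{\alpha-k\rho\})\bigr),$$ and, for $\rho\in(0,1)$,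 $\delta(\rho^-,\alpha)=\lim_{r\to\rho^-}\delta(r,\alpha)$ and $a(\delta,\rho^+,\alpha)=\lim_{r\to\rho^+}a(\delta,r,\alpha)$. Let $\eta_1=(1-\delta-d)/\lambda$, $\eta_2=(1-\delta)/\lambda$, and \begin{align*} M_1&=\{(\delta,a):\delta\in(1-\lambda-d,1-d),\ a\in[0,\eta_1)\},\\ M_2&=\{(\delta,a):\delta\in(1-\lambda-d,1),\ a\in[0,1]\cap[\eta_1,\eta_2]\},\\ M_3&=\{(\delta,a):\delta\in(1-\lambda,1),\ a\in(\eta_2,1]\},\\ \mathcal F_1&=\{(\delta,a):\delta\in(1-\lambda-d,1-\lambda],\ a\in[\tfrac{\delta}{1-\lambda},1]\},\\ \mathcal F_2&=\{(\delta,a):\delta\in[1-d,1),\ a\in[0,\tfrac{\delta+d-1}{1-\lambda}]\}. \end{align*} Theorem. Let $\delta\in(1-\lambda-d,1)$ and $a\in[0,1]$ with $(\delta,a)\notin\mathcal F_1\cup\mathcal F_2$. Then there exist $\rho\in(0,1)$ and $\alpha\in[0,1]$ such that $$\delta\in[\delta(\rho^-,\alpha),\delta(\rho,\alpha)]\quad\text{and}\quad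 a\in[a(\delta,\rho^+,\alpha),a(\delta,\rho,\alpha)].\qquad(*)$$ For all $\rho\in(0,1)$ and $\alpha\in[0,1]$ that satisfy $(*)$, $\rho$ is the rotation number $\rho_f$ of $f$; consequently $\rho_f\in(0,1)$, and $(*)$ holds with $\rho=\rho_f$ for some $\alpha\in[0,1]$. Moreover, every $\alpha\in[0,1]$ for which $(*)$ holds with $\rho=\rho_f$ satisfies: $\alpha\in[0,1-\rho_f]$ if $(\delta,a)\in M_1$; $\alpha\in[1-\rho_f,1]$ if $(\delta,a)\in M_3$; and $\alpha=1-\rho_f$ if $(\delta,a)\in M_2$ and, in addition, $\rho_f\notin\mathbb Q$ or $a\notin\{\eta_1,\eta_2\}$. -/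

import Mathlib

open Set Filter Topology

noncomputable section

namespace PiecewiseContraction

/-- The step function `θ_a`: it is `0` on `(-∞, a)` and `1` on `[a, ∞)`. -/
def theta (a z : ℝ) : ℝ := if z < a then 0 else 1

/-- The lift `F(x) = l x + δ + (1 - l)⌊x⌋ + d θ_a({x})` of the circle map
`f(x) = F(x) mod 1`, `x ∈ [0, 1)`. Here `l` is the contraction rate. -/
def liftF (l d δ a x : ℝ) : ℝ :=
  l * x + δ + (1 - l) * (⌊x⌋ : ℝ) + d * theta a (Int.fract x)

/-- `ρ` is the rotation number of the map with lift `F`: the limit of `F^n(x)/n` exists, is the same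
for every `x`, and `ρ` is its representative modulo `1` in `[0, 1)`. -/
def IsRotationNumber (F : ℝ → ℝ) (ρ : ℝ) : Prop :=
  ∃ τ : ℝ, (∀ x : ℝ, Tendsto (fun n : ℕ => F^[n] x / (n : ℝ)) atTop (𝓝 τ)) ∧ ρ = Int.fract τ

/-- `η₁ = (1 - δ - d) / l`. -/
def eta1 (l d δ : ℝ) : ℝ := (1 - δ - d) / l

/-- `η₂ = (1 - δ) / l`. -/
def eta2 (l δ : ℝ) : ℝ := (1 - δ) / l

/-- Parameters `(δ, a)` of type `M₁`. -/
def M1 (l d : ℝ) : Set (ℝ × ℝ) :=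
  {p | p.1 ∈ Ioo (1 - l - d) (1 - d) ∧ p.2 ∈ Ico 0 (eta1 l d p.1)}

/-- Parameters `(δ, a)` of type `M₂`. -/
def M2 (l d : ℝ) : Set (ℝ × ℝ) :=
  {p | p.1 ∈ Ioo (1 - l - d) 1 ∧ p.2 ∈ Icc 0 1 ∩ Icc (eta1 l d p.1) (eta2 l p.1)}

/-- Parameters `(δ, a)` of type `M₃`. -/
def M3 (l : ℝ) : Set (ℝ × ℝ) :=
  {p | p.1 ∈ Ioo (1 - l) 1 ∧ p.2 ∈ Ioc (eta2 l p.1) 1}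

/-- Parameters `(δ, a)` for which `δ / (1 - l)` is a (ghost) fixed point. -/
def F1 (l d : ℝ) : Set (ℝ × ℝ) :=
  {p | p.1 ∈ Ioc (1 - l - d) (1 - l) ∧ p.2 ∈ Icc (p.1 / (1 - l)) 1}

/-- Parameters `(δ, a)` for which `(δ + d - 1) / (1 - l)` is a fixed point. -/
def F2 (l d : ℝ) : Set (ℝ × ℝ) :=
  {p | p.1 ∈ Ico (1 - d) 1 ∧ p.2 ∈ Icc 0 ((p.1 + d - 1) / (1 - l))}

/-- `ψ_α(z) = (1 - l)⌊z⌋ + d θ_α({z})`. -/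
def psi (l d α z : ℝ) : ℝ := (1 - l) * (⌊z⌋ : ℝ) + d * theta α (Int.fract z)

/-- `δ(ρ, α) = 1 - l - d + ((1 - l) / l) ∑_{k ≥ 1} l^k ((1 - l)⌊kρ⌋ + d θ_{1-α}({kρ}))`;
the summation index is shifted by one. -/
def deltaFun (l d ρ α : ℝ) : ℝ :=
  1 - l - d + (1 - l) / l * ∑' k : ℕ, l ^ (k + 1) * psi l d (1 - α) (((k + 1 : ℕ) : ℝ) * ρ)

/-- `a(δ, ρ, α) = δ / (1 - l) + (1 / l) ∑_{k ≥ 1} l^k ((1 - l)⌊α - kρ⌋ + d θ_α({α - kρ}))`;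
the summation index is shifted by one. -/
def aFun (l d δ ρ α : ℝ) : ℝ :=
  δ / (1 - l) + 1 / l * ∑' k : ℕ, l ^ (k + 1) * psi l d α (α - ((k + 1 : ℕ) : ℝ) * ρ)

/-- The interval conditions `δ ∈ [δ(ρ⁻, α), δ(ρ, α)]` and `a ∈ [a(δ, ρ⁺, α), a(δ, ρ, α)]`, where
`ρ⁻` and `ρ⁺` denote the left and right limits in the variable `ρ`
(both exist, see `tendsto_deltaFun_left` and `tendsto_aFun_right`). -/
def IntervalCond (l d ρ α δ a : ℝ) : Prop :=
  δ ∈ Icc (Function.leftLim (fun r => deltaFun l d r α) ρ) (deltaFun l d ρ α) ∧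
  a ∈ Icc (Function.rightLim (fun r => aFun l d δ r α) ρ) (aFun l d δ ρ α)

/-! The series converge and the one-sided limits exist. -/

lemma theta_nonneg (a z : ℝ) : 0 ≤ theta a z := by
  unfold theta; split_ifs <;> norm_num

lemma theta_le_one (a z : ℝ) : theta a z ≤ 1 := by
  unfold theta; split_ifs <;> norm_num

lemma theta_mono (a : ℝ) : Monotone (theta a) := by
  intro x y h
  unfold theta
  split_ifs <;> linarith

lemma psi_mono {l d : ℝ} (hd : d ∈ Ioo 0 (1 - l)) (α : ℝ) : Monotone (psi l d α) := by
  intro x y h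
  have hfl : ⌊x⌋ ≤ ⌊y⌋ := Int.floor_mono h
  unfold psi
  rcases hfl.eq_or_lt with he | hlt
  · have h1 : theta α (Int.fract x) ≤ theta α (Int.fract y) := by
      apply theta_mono
      have hx := Int.self_sub_floor x
      have hy := Int.self_sub_floor y
      rw [← hx, ← hy, he]
      linarith
    rw [he]
    have := mul_le_mul_of_nonneg_left h1 hd.1.le
    linarith
  · have h2 : (⌊x⌋ : ℝ) + 1 ≤ ⌊y⌋ := by exact_mod_cast hlt
    have h3 := theta_nonneg α (Int.fract y)
    have h4 := theta_le_one α (Int.fract x)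
    nlinarith [hd.1, hd.2, mul_nonneg hd.1.le h3, mul_le_mul_of_nonneg_left h4 hd.1.le,
      mul_le_mul_of_nonneg_left h2 (hd.1.trans hd.2).le]

lemma abs_psi_le {l d : ℝ} (hl : l ∈ Ioo (0 : ℝ) 1) (hd : d ∈ Ioo 0 (1 - l)) (α z : ℝ) :
    |psi l d α z| ≤ |z| + 2 := by
  have h1 := Int.floor_le z
  have h2 := Int.lt_floor_add_one z
  have h3 := theta_nonneg α (Int.fract z)
  have h4 := theta_le_one α (Int.fract z)
  have hf : |(⌊z⌋ : ℝ)| ≤ |z| + 1 := by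
    rw [abs_le]
    constructor <;> linarith [neg_abs_le z, le_abs_self z]
  have h5 : |(1 - l) * (⌊z⌋ : ℝ)| ≤ |z| + 1 := by
    rw [abs_mul, abs_of_pos (by linarith [hl.2] : (0 : ℝ) < 1 - l)]
    nlinarith [hl.1, abs_nonneg (⌊z⌋ : ℝ)]
  have h6 : |d * theta α (Int.fract z)| ≤ 1 := by
    rw [abs_of_nonneg (mul_nonneg hd.1.le h3)]
    nlinarith [hd.1, hd.2, hl.1]
  unfold psi
  exact (abs_add_le _ _).trans (by linarith)

lemma summable_psi {l d : ℝ} (hl : l ∈ Ioo (0 : ℝ) 1) (hd : d ∈ Ioo 0 (1 - l)) (β s ρ : ℝ) :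
    Summable fun k : ℕ => l ^ (k + 1) * psi l d β (s + ((k + 1 : ℕ) : ℝ) * ρ) := by
  have hn : ‖l‖ < 1 := by rw [Real.norm_eq_abs, abs_of_pos hl.1]; exact hl.2
  have h1 : Summable fun k : ℕ => (k : ℝ) ^ 1 * l ^ k :=
    summable_pow_mul_geometric_of_norm_lt_one 1 hn
  have h2 : Summable fun k : ℕ => l ^ k := summable_geometric_of_norm_lt_one hn
  have h3 : Summable fun k : ℕ => |ρ| * ((k : ℝ) ^ 1 * l ^ k) + (|s| + 2) * l ^ k :=
    (h1.mul_left _).add (h2.mul_left _)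
  have h4 := (summable_nat_add_iff 1).2 h3
  refine Summable.of_norm_bounded h4 fun k => ?_
  rw [Real.norm_eq_abs, abs_mul, abs_of_pos (pow_pos hl.1 _)]
  have h5 := abs_psi_le hl hd β (s + ((k + 1 : ℕ) : ℝ) * ρ)
  have h6 : |s + ((k + 1 : ℕ) : ℝ) * ρ| ≤ |s| + ((k + 1 : ℕ) : ℝ) * |ρ| := by
    refine (abs_add_le _ _).trans ?_
    rw [abs_mul, Nat.abs_cast]
  have h7 := mul_le_mul_of_nonneg_left (h5.trans (add_le_add_left h6 2)) (pow_pos hl.1 (k + 1)).le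
  refine h7.trans (le_of_eq ?_)
  ring

lemma summable_deltaFun {l d : ℝ} (hl : l ∈ Ioo (0 : ℝ) 1) (hd : d ∈ Ioo 0 (1 - l)) (ρ α : ℝ) :
    Summable fun k : ℕ => l ^ (k + 1) * psi l d (1 - α) (((k + 1 : ℕ) : ℝ) * ρ) := by
  simpa using summable_psi hl hd (1 - α) 0 ρ

lemma summable_aFun {l d : ℝ} (hl : l ∈ Ioo (0 : ℝ) 1) (hd : d ∈ Ioo 0 (1 - l)) (ρ α : ℝ) :
    Summable fun k : ℕ => l ^ (k + 1) * psi l d α (α - ((k + 1 : ℕ) : ℝ) * ρ) := by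
  simpa [sub_eq_add_neg] using summable_psi hl hd α α (-ρ)

lemma deltaFun_mono {l d : ℝ} (hl : l ∈ Ioo (0 : ℝ) 1) (hd : d ∈ Ioo 0 (1 - l)) (α : ℝ) :
    Monotone fun r => deltaFun l d r α := by
  intro r s h
  have hc : 0 ≤ (1 - l) / l := div_nonneg (by linarith [hl.2]) hl.1.le
  refine add_le_add_right (mul_le_mul_of_nonneg_left ?_ hc) _
  refine (summable_deltaFun hl hd r α).tsum_le_tsum (fun k => ?_) (summable_deltaFun hl hd s α)
  exact mul_le_mul_of_nonneg_left
    (psi_mono hd _ (mul_le_mul_of_nonneg_left h (Nat.cast_nonneg _))) (pow_pos hl.1 _).le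

lemma aFun_anti {l d : ℝ} (hl : l ∈ Ioo (0 : ℝ) 1) (hd : d ∈ Ioo 0 (1 - l)) (δ α : ℝ) :
    Antitone fun r => aFun l d δ r α := by
  intro r s h
  have hc : 0 ≤ 1 / l := div_nonneg zero_le_one hl.1.le
  refine add_le_add_right (mul_le_mul_of_nonneg_left ?_ hc) _
  refine (summable_aFun hl hd s α).tsum_le_tsum (fun k => ?_) (summable_aFun hl hd r α)
  exact mul_le_mul_of_nonneg_left
    (psi_mono hd _ (sub_le_sub_left (mul_le_mul_of_nonneg_left h (Nat.cast_nonneg _)) _))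
    (pow_pos hl.1 _).le

lemma tendsto_deltaFun_left {l d : ℝ} (hl : l ∈ Ioo (0 : ℝ) 1) (hd : d ∈ Ioo 0 (1 - l))
    (ρ α : ℝ) : Tendsto (fun r => deltaFun l d r α) (𝓝[<] ρ)
      (𝓝 (Function.leftLim (fun r => deltaFun l d r α) ρ)) :=
  (deltaFun_mono hl hd α).tendsto_leftLim ρ

lemma tendsto_aFun_right {l d : ℝ} (hl : l ∈ Ioo (0 : ℝ) 1) (hd : d ∈ Ioo 0 (1 - l))
    (δ ρ α : ℝ) : Tendsto (fun r => aFun l d δ r α) (𝓝[>] ρ)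
      (𝓝 (Function.rightLim (fun r => aFun l d δ r α) ρ)) :=
  (aFun_anti hl hd δ α).tendsto_rightLim ρ

end PiecewiseContraction

end

open PiecewiseContraction

/-!
Since `θ_α({z}) = 1 + ⌊z - α⌋ - ⌊z⌋` for `α ∈ [0, 1]`, the lift is
`F(x) = l x + (δ + d) + (1 - l - d)⌊x⌋ + d⌊x - a⌋`. Replacing the arguments of the two floors by `y`
and `y - α` and solving `φ(y + ρ) = l φ(y) + (δ + d) + (1 - l - d)⌊y⌋ + d⌊y - α⌋` gives a monotone
right-continuous function `φ` (`upperConj`) with left-continuous version `φ⁻` (`lowerConj`), both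
commuting with integer translations. The series `deltaFun` and `aFun` are values of `φ⁻` and `φ`,
and their one-sided limits in `ρ` exchange `φ` and `φ⁻`, so the interval conditions become
`φ⁻(0) ≤ 0 ≤ φ(0)` and `φ⁻(α) ≤ a ≤ φ(α)` (`intervalCond_iff`).

* If `0 ≤ φ(0)` and `a ≤ φ(α)`, then `φ(y + ρ) ≤ F(φ(y))`, so the translation number `τ` of `F` is
  at least `ρ`; the two other inequalities give `τ ≤ ρ` in the same way
  (`le_translationNumber_of_upperConj`, `translationNumber_le_of_lowerConj`). So the interval
  conditions determine `ρ`.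
* By semicontinuity in `ρ`, `φ(0) < 0` and `φ(α) < a` together force `τ < ρ`, and `0 < φ⁻(0)` and
  `a < φ⁻(α)` together force `ρ < τ`. For `ρ = τ` neither pair can occur, and an argument with the
  connectedness of `[0, 1]` in the variable `α` produces a solution (`exists_conj`). No distinction
  between rational and irrational rotation numbers is needed.
* Outside `F1 ∪ F2` the displacement `F(x) - x` stays in a compact part of `(0, 1)`, hence
  `τ ∈ (0, 1)` (`translationNumber_pos`, `translationNumber_lt_one`).
* Evaluating the functional equation at `y = α` and comparing `α + ρ` with `1` gives `a ≥ η₂` if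
  `α > 1 - ρ` and `a ≤ η₁` if `α < 1 - ρ`, strictly if `ρ` is irrational, because `φ` is then
  strictly increasing (`one_le_of_one_sub_lt`, `le_one_of_lt_one_sub`).
-/

open Set Filter Topology

namespace PiecewiseContraction

/-! ### Discounted sums of floors and ceilings -/

/-- The sum `∑_{k ≥ 1} l^(k-1) ⌊y - kρ⌋`, with the index shifted by one. It is nondecreasing and
right-continuous in `y`. -/
noncomputable def floorSum (l ρ y : ℝ) : ℝ := ∑' k : ℕ, l ^ k * (⌊y - (k + 1) * ρ⌋ : ℝ)

/-- The left limit in `y` of `floorSum`: each floor `⌊z⌋` is replaced by its left limit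
`⌈z⌉ - 1`. -/
noncomputable def ceilSum (l ρ y : ℝ) : ℝ := ∑' k : ℕ, l ^ k * ((⌈y - (k + 1) * ρ⌉ : ℝ) - 1)

lemma summable_affine {l : ℝ} (hl : l ∈ Ioo (0 : ℝ) 1) (A B : ℝ) :
    Summable fun k : ℕ => l ^ k * (A + B * k) := by
  have hn : ‖l‖ < 1 := by rw [Real.norm_eq_abs, abs_of_pos hl.1]; exact hl.2
  have h1 : Summable fun k : ℕ => (k : ℝ) ^ 1 * l ^ k :=
    summable_pow_mul_geometric_of_norm_lt_one 1 hn
  have h2 : Summable fun k : ℕ => l ^ k := summable_geometric_of_norm_lt_one hn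
  exact ((h2.mul_left A).add (h1.mul_left B)).congr fun k => by ring

lemma abs_floor_le (z : ℝ) : |(⌊z⌋ : ℝ)| ≤ |z| + 1 := by
  have h1 := Int.floor_le z
  have h2 := Int.lt_floor_add_one z
  rw [abs_le]
  constructor <;> linarith [neg_abs_le z, le_abs_self z]

lemma abs_floor_sub_le (y r : ℝ) (k : ℕ) :
    |(⌊y - (k + 1) * r⌋ : ℝ)| ≤ (|y| + |r| + 1) + |r| * k := by
  refine (abs_floor_le _).trans ?_
  have h := abs_sub y ((k + 1) * r)
  rw [abs_mul, abs_of_nonneg (by positivity : (0 : ℝ) ≤ k + 1)] at h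
  linarith

lemma summable_floorSum {l : ℝ} (hl : l ∈ Ioo (0 : ℝ) 1) (ρ y : ℝ) :
    Summable fun k : ℕ => l ^ k * (⌊y - (k + 1) * ρ⌋ : ℝ) := by
  refine Summable.of_norm_bounded (summable_affine hl (|y| + |ρ| + 1) |ρ|) fun k => ?_
  rw [Real.norm_eq_abs, abs_mul, abs_of_pos (pow_pos hl.1 _)]
  exact mul_le_mul_of_nonneg_left (abs_floor_sub_le y ρ k) (pow_pos hl.1 _).le

lemma summable_pow {l : ℝ} (hl : l ∈ Ioo (0 : ℝ) 1) : Summable fun k : ℕ => l ^ k :=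
  summable_geometric_of_lt_one hl.1.le hl.2

lemma ceil_sub_one_eq (l ρ y : ℝ) (k : ℕ) : l ^ k * ((⌈y - (k + 1) * ρ⌉ : ℝ) - 1) =
    -(l ^ k * (⌊-y - (k + 1) * -ρ⌋ : ℝ)) - l ^ k := by
  rw [show -y - (k + 1) * -ρ = -(y - (k + 1) * ρ) by ring, Int.floor_neg]
  push_cast
  ring

/-- The reflection `y ↦ -y`, `ρ ↦ -ρ` exchanges the two sums, so that every fact about one of them
gives a fact about the other. -/
lemma ceilSum_eq {l : ℝ} (hl : l ∈ Ioo (0 : ℝ) 1) (ρ y : ℝ) :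
    ceilSum l ρ y = -floorSum l (-ρ) (-y) - 1 / (1 - l) := by
  unfold ceilSum floorSum
  rw [tsum_congr (ceil_sub_one_eq l ρ y),
    (summable_floorSum hl (-ρ) (-y)).neg.tsum_sub (summable_pow hl), tsum_neg,
    tsum_geometric_of_lt_one hl.1.le hl.2, one_div]

lemma floorSum_eq {l : ℝ} (hl : l ∈ Ioo (0 : ℝ) 1) (ρ y : ℝ) :
    floorSum l ρ y = -ceilSum l (-ρ) (-y) - 1 / (1 - l) := by
  rw [ceilSum_eq hl, neg_neg, neg_neg]; ring

lemma summable_ceilSum {l : ℝ} (hl : l ∈ Ioo (0 : ℝ) 1) (ρ y : ℝ) :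
    Summable fun k : ℕ => l ^ k * ((⌈y - (k + 1) * ρ⌉ : ℝ) - 1) :=
  ((summable_floorSum hl (-ρ) (-y)).neg.sub (summable_pow hl)).congr
    fun k => (ceil_sub_one_eq l ρ y k).symm

lemma floorSum_mono {l : ℝ} (hl : l ∈ Ioo (0 : ℝ) 1) {ρ ρ' y y' : ℝ} (hρ : ρ' ≤ ρ) (hy : y ≤ y') :
    floorSum l ρ y ≤ floorSum l ρ' y' := by
  refine (summable_floorSum hl ρ y).tsum_le_tsum (fun k => ?_) (summable_floorSum hl ρ' y')
  have := pow_pos hl.1 k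
  gcongr

lemma ceilSum_mono {l : ℝ} (hl : l ∈ Ioo (0 : ℝ) 1) {ρ ρ' y y' : ℝ} (hρ : ρ' ≤ ρ) (hy : y ≤ y') :
    ceilSum l ρ y ≤ ceilSum l ρ' y' := by
  rw [ceilSum_eq hl, ceilSum_eq hl]
  linarith [floorSum_mono hl (neg_le_neg hρ) (neg_le_neg hy)]

lemma ceilSum_le_floorSum {l : ℝ} (hl : l ∈ Ioo (0 : ℝ) 1) (ρ y : ℝ) :
    ceilSum l ρ y ≤ floorSum l ρ y := by
  refine (summable_ceilSum hl ρ y).tsum_le_tsum (fun k => ?_) (summable_floorSum hl ρ y)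
  refine mul_le_mul_of_nonneg_left ?_ (pow_pos hl.1 k).le
  have : (⌈y - (k + 1) * ρ⌉ : ℝ) ≤ ⌊y - (k + 1) * ρ⌋ + 1 := by
    exact_mod_cast Int.ceil_le_floor_add_one _
  linarith

lemma floor_le_ceil_sub_one {z w : ℝ} (h : z < w) : (⌊z⌋ : ℝ) ≤ (⌈w⌉ : ℝ) - 1 := by
  have h1 : ⌊z⌋ < ⌈w⌉ := Int.lt_ceil.2 ((Int.floor_le z).trans_lt h)
  have h2 : (⌊z⌋ : ℝ) + 1 ≤ ⌈w⌉ := by exact_mod_cast h1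
  linarith

lemma floorSum_le_ceilSum {l : ℝ} (hl : l ∈ Ioo (0 : ℝ) 1) {ρ ρ' y y' : ℝ}
    (h : ∀ k : ℕ, y - (k + 1) * ρ < y' - (k + 1) * ρ') :
    floorSum l ρ y ≤ ceilSum l ρ' y' :=
  (summable_floorSum hl ρ y).tsum_le_tsum
    (fun k => mul_le_mul_of_nonneg_left (floor_le_ceil_sub_one (h k)) (pow_pos hl.1 k).le)
    (summable_ceilSum hl ρ' y')

lemma floorSum_le_ceilSum_of_lt {l : ℝ} (hl : l ∈ Ioo (0 : ℝ) 1) (ρ : ℝ) {y y' : ℝ} (h : y < y') :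
    floorSum l ρ y ≤ ceilSum l ρ y' :=
  floorSum_le_ceilSum hl fun k => by linarith

lemma floorSum_add_int {l : ℝ} (hl : l ∈ Ioo (0 : ℝ) 1) (ρ y : ℝ) (n : ℤ) :
    floorSum l ρ (y + n) = floorSum l ρ y + n / (1 - l) := by
  unfold floorSum
  rw [div_eq_mul_inv, ← tsum_geometric_of_lt_one hl.1.le hl.2, ← tsum_mul_left,
    ← (summable_floorSum hl ρ y).tsum_add ((summable_pow hl).mul_left _)]
  refine tsum_congr fun k => ?_
  rw [show y + n - (k + 1) * ρ = y - (k + 1) * ρ + n by ring, Int.floor_add_intCast]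
  push_cast
  ring

lemma ceilSum_add_int {l : ℝ} (hl : l ∈ Ioo (0 : ℝ) 1) (ρ y : ℝ) (n : ℤ) :
    ceilSum l ρ (y + n) = ceilSum l ρ y + n / (1 - l) := by
  have h := floorSum_add_int hl (-ρ) (-y) (-n)
  rw [ceilSum_eq hl, ceilSum_eq hl, neg_add, show -(n : ℝ) = ((-n : ℤ) : ℝ) by push_cast; rfl, h]
  push_cast
  ring

lemma floorSum_add_self {l : ℝ} (hl : l ∈ Ioo (0 : ℝ) 1) (ρ y : ℝ) :
    floorSum l ρ (y + ρ) = ⌊y⌋ + l * floorSum l ρ y := by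
  unfold floorSum
  rw [(summable_floorSum hl ρ (y + ρ)).tsum_eq_zero_add, ← tsum_mul_left]
  congr 1
  · simp
  · refine tsum_congr fun k => ?_
    rw [show y + ρ - ((k + 1 : ℕ) + 1) * ρ = y - (k + 1) * ρ by push_cast; ring]
    ring

lemma ceilSum_add_self {l : ℝ} (hl : l ∈ Ioo (0 : ℝ) 1) (ρ y : ℝ) :
    ceilSum l ρ (y + ρ) = (⌈y⌉ - 1) + l * ceilSum l ρ y := by
  have h := floorSum_add_self hl (-ρ) (-y)
  have h1 : 1 - l ≠ 0 := by linarith [hl.2]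
  rw [ceilSum_eq hl, ceilSum_eq hl, neg_add, h, Int.floor_neg]
  push_cast
  field_simp
  ring

/-- Continuity jointly in `ρ` from the left and in `y` from the right. With the monotonicity of
`floorSum` and `ceilSum` in both variables it yields all the one-sided limits needed. -/
lemma tendsto_floorSum_aux {l : ℝ} (hl : l ∈ Ioo (0 : ℝ) 1) (ρ y : ℝ) :
    Tendsto (fun r => floorSum l r (y + (ρ - r))) (𝓝[<] ρ) (𝓝 (floorSum l ρ y)) := by
  refine tendsto_tsum_of_dominated_convergence
    (summable_affine hl ((|y| + 1) + (|ρ| + 1) + 1) (|ρ| + 1)) (fun k => ?_) ?_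
  · refine tendsto_nhds_of_eventually_eq ?_
    have hz := Int.lt_floor_add_one (y - (k + 1) * ρ)
    have hk : (0 : ℝ) < k + 2 := by positivity
    have hlim : ρ - (⌊y - (k + 1) * ρ⌋ + 1 - (y - (k + 1) * ρ)) / (k + 2) < ρ := by
      have := div_pos (sub_pos.2 hz) hk
      linarith
    filter_upwards [Ioo_mem_nhdsLT hlim] with r hr
    have h1 : (ρ - r) * (k + 2) < ⌊y - (k + 1) * ρ⌋ + 1 - (y - (k + 1) * ρ) := by
      rw [← lt_div_iff₀ hk]; linarith [hr.1]
    have h2 : 0 < (ρ - r) * (k + 2) := mul_pos (sub_pos.2 hr.2) hk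
    congr 2
    rw [Int.floor_eq_iff]
    constructor <;> nlinarith [Int.floor_le (y - (k + 1) * ρ)]
  · filter_upwards [Ioo_mem_nhdsLT (show ρ - 1 < ρ by linarith)] with r hr k
    rw [Real.norm_eq_abs, abs_mul, abs_of_pos (pow_pos hl.1 _)]
    refine mul_le_mul_of_nonneg_left ((abs_floor_sub_le _ r k).trans ?_) (pow_pos hl.1 _).le
    have h1 : |y + (ρ - r)| ≤ |y| + 1 := by
      refine (abs_add_le _ _).trans ?_
      rw [abs_of_pos (sub_pos.2 hr.2)]; linarith [hr.1]
    have h2 : |r| ≤ |ρ| + 1 := by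
      have := abs_add_le ρ (r - ρ)
      rw [abs_of_neg (sub_neg.2 hr.2)] at this
      have h3 : ρ + (r - ρ) = r := by ring
      rw [h3] at this
      linarith [hr.1]
    gcongr

lemma tendsto_ceilSum_left {l : ℝ} (hl : l ∈ Ioo (0 : ℝ) 1) (ρ y : ℝ) :
    Tendsto (fun r => ceilSum l r y) (𝓝[<] ρ) (𝓝 (floorSum l ρ y)) := by
  refine tendsto_of_tendsto_of_tendsto_of_le_of_le' tendsto_const_nhds
    (tendsto_floorSum_aux hl ρ y) ?_ ?_
  · filter_upwards [self_mem_nhdsWithin] with r (hr : r < ρ)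
    refine floorSum_le_ceilSum hl fun k => ?_
    have := mul_lt_mul_of_pos_left hr (by positivity : (0 : ℝ) < k + 1)
    linarith
  · filter_upwards [self_mem_nhdsWithin] with r (hr : r < ρ)
    exact (ceilSum_le_floorSum hl r y).trans (floorSum_mono hl le_rfl (by linarith))

lemma tendsto_floorSum_right {l : ℝ} (hl : l ∈ Ioo (0 : ℝ) 1) (ρ y : ℝ) :
    Tendsto (fun r => floorSum l r y) (𝓝[>] ρ) (𝓝 (ceilSum l ρ y)) := by
  have h := ((tendsto_ceilSum_left hl (-ρ) (-y)).comp tendsto_neg_nhdsGT).neg.sub_const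
    (1 / (1 - l))
  rw [← ceilSum_eq hl] at h
  exact h.congr fun r => (floorSum_eq hl r y).symm

/-- `floorSum` is upper semicontinuous in `y`. -/
lemma isOpen_floorSum_lt {l : ℝ} (hl : l ∈ Ioo (0 : ℝ) 1) (ρ t : ℝ) :
    IsOpen {y | floorSum l ρ y < t} := by
  refine isOpen_iff_mem_nhds.2 fun y hy => ?_
  obtain ⟨r, hr, hrρ⟩ := (((tendsto_floorSum_aux hl ρ y).eventually_lt_const hy).and
    self_mem_nhdsWithin).exists
  filter_upwards [Iio_mem_nhds (show y < y + (ρ - r) by linarith [show r < ρ from hrρ])] with z hz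
  exact (floorSum_mono hl (show r < ρ from hrρ).le (show z < _ from hz).le).trans_lt hr

/-- `ceilSum` is lower semicontinuous in `y`. -/
lemma isOpen_lt_ceilSum {l : ℝ} (hl : l ∈ Ioo (0 : ℝ) 1) (ρ t : ℝ) :
    IsOpen {y | t < ceilSum l ρ y} := by
  convert (isOpen_floorSum_lt hl (-ρ) (-t - 1 / (1 - l))).preimage continuous_neg using 1
  ext y
  simp only [mem_ofPred_eq, mem_preimage, ceilSum_eq hl]
  constructor <;> intro h <;> linarith

/-- For irrational `ρ` the numbers `kρ + m`, with `k ≥ 1` and `m` an integer, are dense. -/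
lemma exists_nat_mul_add_int_mem_Ioo {ρ : ℝ} (hρ : Irrational ρ) {y z : ℝ} (h : y < z) :
    ∃ (k : ℕ) (m : ℤ), (k + 1) * ρ + m ∈ Ioo y z := by
  have h1 : DenseRange (· • (ρ : AddCircle (1 : ℝ)) : ℕ → AddCircle (1 : ℝ)) := by
    rw [← denseRange_zsmul_iff_nsmul, AddCircle.denseRange_zsmul_coe_iff, div_one]
    exact hρ
  have h2 := QuotientAddGroup.dense_preimage_mk.2 h1
  obtain ⟨w, ⟨k, hk⟩, hw⟩ := h2.exists_mem_open isOpen_Ioo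
    (nonempty_Ioo.2 (sub_lt_sub_right h ρ))
  have h3 : ((w - k * ρ : ℝ) : AddCircle (1 : ℝ)) = 0 := by
    have h4 : k • (ρ : AddCircle (1 : ℝ)) = (w : AddCircle (1 : ℝ)) := hk
    rw [AddCircle.coe_sub, ← h4, ← nsmul_eq_mul, AddCircle.coe_nsmul, sub_self]
  obtain ⟨m, hm⟩ := AddCircle.coe_eq_zero_iff 1 |>.1 h3
  rw [zsmul_eq_mul, mul_one] at hm
  refine ⟨k, m, ?_, ?_⟩ <;> rw [hm] <;> linarith [hw.1, hw.2]

/-- For irrational `ρ` the jumps `kρ + m` of `floorSum` are dense, hence it is strictly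
increasing. -/
lemma floorSum_lt_ceilSum {l : ℝ} (hl : l ∈ Ioo (0 : ℝ) 1) {ρ : ℝ} (hρ : Irrational ρ) {y z : ℝ}
    (h : y < z) : floorSum l ρ y < ceilSum l ρ z := by
  obtain ⟨k, m, hm⟩ := exists_nat_mul_add_int_mem_Ioo hρ h
  refine (summable_floorSum hl ρ y).tsum_lt_tsum (i := k) (fun j => ?_) ?_
    (summable_ceilSum hl ρ z)
  · exact mul_le_mul_of_nonneg_left (floor_le_ceil_sub_one (by linarith)) (pow_pos hl.1 j).le
  · refine mul_lt_mul_of_pos_left ?_ (pow_pos hl.1 k)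
    have h1 : ⌊y - (k + 1) * ρ⌋ < m := Int.floor_lt.2 (by linarith [hm.1])
    have h2 : m < ⌈z - (k + 1) * ρ⌉ := Int.lt_ceil.2 (by linarith [hm.2])
    have h3 : (⌊y - (k + 1) * ρ⌋ : ℝ) < m := by exact_mod_cast h1
    have h4 : (m : ℝ) + 1 ≤ ⌈z - (k + 1) * ρ⌉ := by exact_mod_cast h2
    linarith

/-! ### The two candidate semiconjugacies and the interval conditions -/

/-- The candidate `φ` for a semiconjugacy from the translation by `ρ` to the lift `F`: the solution
of `φ(y + ρ) = l φ(y) + δ + ψ_α(y)` that commutes with integer translations. It is right-continuous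
and jumps where `y - kρ` or `y - kρ - α` is an integer. -/
noncomputable def upperConj (l d δ ρ α y : ℝ) : ℝ :=
  (δ + d) / (1 - l) + (1 - l - d) * floorSum l ρ y + d * floorSum l ρ (y - α)

/-- The left-continuous version `φ⁻` of `upperConj`. -/
noncomputable def lowerConj (l d δ ρ α y : ℝ) : ℝ :=
  (δ + d) / (1 - l) + (1 - l - d) * ceilSum l ρ y + d * ceilSum l ρ (y - α)

/-- For a threshold in the closed unit interval, both endpoints included, `θ_α({z})` is a difference
of floors. This puts the jumps of `F` at `0` and at `a` on the same footing. -/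
lemma theta_fract {α : ℝ} (hα : α ∈ Icc (0 : ℝ) 1) (z : ℝ) :
    theta α (Int.fract z) = 1 + ⌊z - α⌋ - ⌊z⌋ := by
  have hz := Int.floor_add_fract z
  have h0 := Int.fract_nonneg z
  have h1 := Int.fract_lt_one z
  unfold theta
  split_ifs with h
  · have : ⌊z - α⌋ = ⌊z⌋ - 1 := by
      rw [Int.floor_eq_iff]
      push_cast
      constructor <;> linarith [hα.1, hα.2]
    rw [this]; push_cast; ring
  · have : ⌊z - α⌋ = ⌊z⌋ := by
      rw [Int.floor_eq_iff]
      constructor <;> linarith [hα.1, hα.2]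
    rw [this]; ring

lemma psi_eq (l d : ℝ) {α : ℝ} (hα : α ∈ Icc (0 : ℝ) 1) (z : ℝ) :
    psi l d α z = (1 - l - d) * ⌊z⌋ + d * ⌊z - α⌋ + d := by
  rw [psi, theta_fract hα]; ring

lemma liftF_eq (l d δ : ℝ) {a : ℝ} (ha : a ∈ Icc (0 : ℝ) 1) (x : ℝ) :
    liftF l d δ a x = l * x + (δ + d) + (1 - l - d) * ⌊x⌋ + d * ⌊x - a⌋ := by
  rw [liftF, theta_fract ha]; ring

lemma upperConj_mono {l d : ℝ} (hl : l ∈ Ioo (0 : ℝ) 1) (hd : d ∈ Ioo 0 (1 - l)) (δ ρ α : ℝ) :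
    Monotone (upperConj l d δ ρ α) := by
  intro x y h
  have h1 := mul_le_mul_of_nonneg_left (floorSum_mono hl (le_refl ρ) h) (sub_nonneg.2 hd.2.le)
  have h2 := mul_le_mul_of_nonneg_left
    (floorSum_mono hl (le_refl ρ) (sub_le_sub_right h α)) hd.1.le
  unfold upperConj
  linarith

lemma lowerConj_mono {l d : ℝ} (hl : l ∈ Ioo (0 : ℝ) 1) (hd : d ∈ Ioo 0 (1 - l)) (δ ρ α : ℝ) :
    Monotone (lowerConj l d δ ρ α) := by
  intro x y h
  have h1 := mul_le_mul_of_nonneg_left (ceilSum_mono hl (le_refl ρ) h) (sub_nonneg.2 hd.2.le)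
  have h2 := mul_le_mul_of_nonneg_left
    (ceilSum_mono hl (le_refl ρ) (sub_le_sub_right h α)) hd.1.le
  unfold lowerConj
  linarith

/-- This rests on `∑_{k ≥ 1} l^(k-1) = 1 / (1 - l)`: the weights `1 - l - d` and `d` add up to
`1 - l`. -/
lemma upperConj_add_int {l : ℝ} (hl : l ∈ Ioo (0 : ℝ) 1) (d δ ρ α y : ℝ) (n : ℤ) :
    upperConj l d δ ρ α (y + n) = upperConj l d δ ρ α y + n := by
  have h : 1 - l ≠ 0 := by linarith [hl.2]
  rw [upperConj, upperConj, add_sub_right_comm, floorSum_add_int hl, floorSum_add_int hl]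
  field_simp
  ring

lemma lowerConj_add_int {l : ℝ} (hl : l ∈ Ioo (0 : ℝ) 1) (d δ ρ α y : ℝ) (n : ℤ) :
    lowerConj l d δ ρ α (y + n) = lowerConj l d δ ρ α y + n := by
  have h : 1 - l ≠ 0 := by linarith [hl.2]
  rw [lowerConj, lowerConj, add_sub_right_comm, ceilSum_add_int hl, ceilSum_add_int hl]
  field_simp
  ring

lemma upperConj_add_self {l : ℝ} (hl : l ∈ Ioo (0 : ℝ) 1) (d δ ρ α y : ℝ) :
    upperConj l d δ ρ α (y + ρ) =
      l * upperConj l d δ ρ α y + (δ + d) + (1 - l - d) * ⌊y⌋ + d * ⌊y - α⌋ := by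
  have h : 1 - l ≠ 0 := by linarith [hl.2]
  rw [upperConj, upperConj, add_sub_right_comm, floorSum_add_self hl, floorSum_add_self hl]
  field_simp
  ring

lemma lowerConj_add_self {l : ℝ} (hl : l ∈ Ioo (0 : ℝ) 1) (d δ ρ α y : ℝ) :
    lowerConj l d δ ρ α (y + ρ) = l * lowerConj l d δ ρ α y + (δ + d) +
      (1 - l - d) * (⌈y⌉ - 1) + d * (⌈y - α⌉ - 1) := by
  have h : 1 - l ≠ 0 := by linarith [hl.2]
  rw [lowerConj, lowerConj, add_sub_right_comm, ceilSum_add_self hl, ceilSum_add_self hl]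
  field_simp
  ring

lemma lowerConj_le_upperConj {l d : ℝ} (hl : l ∈ Ioo (0 : ℝ) 1) (hd : d ∈ Ioo 0 (1 - l))
    (δ ρ α y : ℝ) :
    lowerConj l d δ ρ α y ≤ upperConj l d δ ρ α y := by
  have h1 := mul_le_mul_of_nonneg_left (ceilSum_le_floorSum hl ρ y) (sub_nonneg.2 hd.2.le)
  have h2 := mul_le_mul_of_nonneg_left (ceilSum_le_floorSum hl ρ (y - α)) hd.1.le
  unfold lowerConj upperConj
  linarith

lemma upperConj_le_lowerConj {l d : ℝ} (hl : l ∈ Ioo (0 : ℝ) 1) (hd : d ∈ Ioo 0 (1 - l)) (δ ρ α : ℝ)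
    {y z : ℝ} (h : y < z) : upperConj l d δ ρ α y ≤ lowerConj l d δ ρ α z := by
  have h1 := mul_le_mul_of_nonneg_left (floorSum_le_ceilSum_of_lt hl ρ h) (sub_nonneg.2 hd.2.le)
  have h2 := mul_le_mul_of_nonneg_left
    (floorSum_le_ceilSum_of_lt hl ρ (sub_lt_sub_right h α)) hd.1.le
  unfold lowerConj upperConj
  linarith

lemma upperConj_lt_lowerConj {l d : ℝ} (hl : l ∈ Ioo (0 : ℝ) 1) (hd : d ∈ Ioo 0 (1 - l))
    (δ : ℝ) {ρ : ℝ} (hρ : Irrational ρ) (α : ℝ) {y z : ℝ} (h : y < z) :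
    upperConj l d δ ρ α y < lowerConj l d δ ρ α z := by
  have h1 := mul_lt_mul_of_pos_left (floorSum_lt_ceilSum hl hρ h) (sub_pos.2 hd.2)
  have h2 := mul_lt_mul_of_pos_left
    (floorSum_lt_ceilSum hl hρ (sub_lt_sub_right h α)) hd.1
  unfold lowerConj upperConj
  linarith

lemma tendsto_lowerConj_left {l : ℝ} (hl : l ∈ Ioo (0 : ℝ) 1) (d δ ρ α y : ℝ) :
    Tendsto (fun r => lowerConj l d δ r α y) (𝓝[<] ρ) (𝓝 (upperConj l d δ ρ α y)) :=
  (((tendsto_ceilSum_left hl ρ y).const_mul _).const_add _).add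
    ((tendsto_ceilSum_left hl ρ (y - α)).const_mul _)

lemma tendsto_upperConj_right {l : ℝ} (hl : l ∈ Ioo (0 : ℝ) 1) (d δ ρ α y : ℝ) :
    Tendsto (fun r => upperConj l d δ r α y) (𝓝[>] ρ) (𝓝 (lowerConj l d δ ρ α y)) :=
  (((tendsto_floorSum_right hl ρ y).const_mul _).const_add _).add
    ((tendsto_floorSum_right hl ρ (y - α)).const_mul _)

lemma aFun_eq {l : ℝ} (hl : l ∈ Ioo (0 : ℝ) 1) (d δ ρ : ℝ) {α : ℝ} (hα : α ∈ Icc (0 : ℝ) 1) :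
    aFun l d δ ρ α = upperConj l d δ ρ α α := by
  have hl0 := hl.1.ne'
  have h : HasSum (fun k : ℕ => l ^ (k + 1) * psi l d α (α - ((k + 1 : ℕ) : ℝ) * ρ))
      (l * ((1 - l - d) * floorSum l ρ α + d * floorSum l ρ (α - α) + d * (1 - l)⁻¹)) := by
    refine (((((summable_floorSum hl ρ α).hasSum.mul_left (1 - l - d)).add
      ((summable_floorSum hl ρ (α - α)).hasSum.mul_left d)).add
      ((hasSum_geometric_of_lt_one hl.1.le hl.2).mul_left d)).mul_left l).congr_fun fun k => ?_
    rw [psi_eq l d hα, show α - ((k + 1 : ℕ) : ℝ) * ρ - α = α - α - (k + 1) * ρ by push_cast; ring]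
    push_cast
    ring
  rw [aFun, h.tsum_eq, upperConj]
  field_simp
  ring

/-- The right-hand side does not depend on `δ`: the constant term of `lowerConj` is
`(δ + d) / (1 - l)`. -/
lemma deltaFun_eq {l : ℝ} (hl : l ∈ Ioo (0 : ℝ) 1) (d δ ρ : ℝ) {α : ℝ} (hα : α ∈ Icc (0 : ℝ) 1) :
    deltaFun l d ρ α = δ - (1 - l) * lowerConj l d δ ρ α 0 := by
  have hl0 := hl.1.ne'
  have hl1 : 1 - l ≠ 0 := by linarith [hl.2]
  have h : HasSum (fun k : ℕ => l ^ (k + 1) * psi l d (1 - α) (((k + 1 : ℕ) : ℝ) * ρ))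
      (l * (-((1 - l - d) * ceilSum l ρ 0) - d * ceilSum l ρ (0 - α)
        - (1 - l) * (1 - l)⁻¹)) := by
    refine (((((summable_ceilSum hl ρ 0).hasSum.mul_left (1 - l - d)).neg.sub
      ((summable_ceilSum hl ρ (0 - α)).hasSum.mul_left d)).sub
      ((hasSum_geometric_of_lt_one hl.1.le hl.2).mul_left (1 - l))).mul_left l).congr_fun
      fun k => ?_
    rw [psi_eq l d ⟨by linarith [hα.2], by linarith [hα.1]⟩,
      show ((k + 1 : ℕ) : ℝ) * ρ = -(0 - (k + 1) * ρ) by push_cast; ring,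
      show -(0 - ((k : ℝ) + 1) * ρ) - (1 - α) = -(0 - α - (k + 1) * ρ + (1 : ℤ)) by
        push_cast; ring, Int.floor_neg, Int.floor_neg, Int.ceil_add_intCast]
    push_cast
    ring
  rw [deltaFun, h.tsum_eq, lowerConj]
  field_simp
  ring

/-- The interval conditions say that `φ` passes the level `0` at `0` and the level `a` at `α`, that
is, `φ⁻(0) ≤ 0 ≤ φ(0)` and `φ⁻(α) ≤ a ≤ φ(α)`. -/
lemma intervalCond_iff {l : ℝ} (hl : l ∈ Ioo (0 : ℝ) 1) (d δ ρ a : ℝ) {α : ℝ}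
    (hα : α ∈ Icc (0 : ℝ) 1) :
    IntervalCond l d ρ α δ a ↔
      (0 ≤ upperConj l d δ ρ α 0 ∧ lowerConj l d δ ρ α 0 ≤ 0) ∧
      (lowerConj l d δ ρ α α ≤ a ∧ a ≤ upperConj l d δ ρ α α) := by
  have h1 : Function.leftLim (fun r => deltaFun l d r α) ρ =
      δ - (1 - l) * upperConj l d δ ρ α 0 := by
    refine leftLim_eq_of_tendsto ?_
    simp_rw [deltaFun_eq hl d δ _ hα]
    exact ((tendsto_lowerConj_left hl d δ ρ α 0).const_mul _).const_sub _
  have h2 : Function.rightLim (fun r => aFun l d δ r α) ρ = lowerConj l d δ ρ α α := by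
    refine rightLim_eq_of_tendsto ?_
    simp_rw [aFun_eq hl d δ _ hα]
    exact tendsto_upperConj_right hl d δ ρ α α
  have h3 : 0 < 1 - l := by linarith [hl.2]
  rw [IntervalCond, h1, h2, deltaFun_eq hl d δ ρ hα, aFun_eq hl d δ ρ hα, mem_Icc, mem_Icc,
    sub_le_self_iff, le_sub_self_iff, mul_nonneg_iff_of_pos_left h3,
    ← mul_le_mul_iff_right₀ h3 (b := lowerConj l d δ ρ α 0), mul_zero]

/-! ### The interval conditions and the translation number -/

/-- The lift `F` as a monotone degree one map of the line. -/
noncomputable def liftMap {l d : ℝ} (hl : l ∈ Ioo (0 : ℝ) 1) (hd : d ∈ Ioo 0 (1 - l)) (δ a : ℝ) :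
    CircleDeg1Lift where
  toFun := liftF l d δ a
  monotone' x y h := by
    have h1 := psi_mono hd a h
    have h2 := mul_le_mul_of_nonneg_left h hl.1.le
    unfold psi at h1
    unfold liftF
    linarith
  map_add_one' x := by
    simp only [liftF, Int.floor_add_one, Int.fract_add_one]
    push_cast
    ring

lemma coe_liftMap {l d : ℝ} (hl : l ∈ Ioo (0 : ℝ) 1) (hd : d ∈ Ioo 0 (1 - l)) (δ a : ℝ) :
    ⇑(liftMap hl hd δ a) = liftF l d δ a := rfl

lemma tendsto_iterate_div (f : CircleDeg1Lift) (x : ℝ) :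
    Tendsto (fun n : ℕ => f^[n] x / (n : ℝ)) atTop (𝓝 f.translationNumber) := by
  have h := (f.tendsto_translationNumber x).add (tendsto_const_div_atTop_nhds_zero_nat x)
  rw [add_zero] at h
  refine h.congr fun n => ?_
  rw [CircleDeg1Lift.coe_pow]
  ring

lemma le_translationNumber_of_le_iterate (f : CircleDeg1Lift) {x ρ C : ℝ}
    (h : ∀ n : ℕ, n * ρ + C ≤ f^[n] x) : ρ ≤ f.translationNumber := by
  have h1 : Tendsto (fun n : ℕ => ρ + C / (n : ℝ)) atTop (𝓝 ρ) := by
    simpa using (tendsto_const_div_atTop_nhds_zero_nat C).const_add ρ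
  refine le_of_tendsto_of_tendsto h1 (tendsto_iterate_div f x) ?_
  filter_upwards [eventually_gt_atTop 0] with n hn
  have hn' : (0 : ℝ) < n := by exact_mod_cast hn
  rw [le_div_iff₀ hn', add_mul, div_mul_cancel₀ _ hn'.ne']
  linarith [h n]

lemma translationNumber_le_of_iterate_le (f : CircleDeg1Lift) {x ρ C : ℝ}
    (h : ∀ n : ℕ, f^[n] x ≤ n * ρ + C) : f.translationNumber ≤ ρ := by
  have h1 : Tendsto (fun n : ℕ => ρ + C / (n : ℝ)) atTop (𝓝 ρ) := by
    simpa using (tendsto_const_div_atTop_nhds_zero_nat C).const_add ρ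
  refine le_of_tendsto_of_tendsto (tendsto_iterate_div f x) h1 ?_
  filter_upwards [eventually_gt_atTop 0] with n hn
  have hn' : (0 : ℝ) < n := by exact_mod_cast hn
  rw [div_le_iff₀ hn', add_mul, div_mul_cancel₀ _ hn'.ne']
  linarith [h n]

/-- If `φ` is large enough at `0` and at `α`, then `F` dominates the translation by `ρ` along
`φ`. -/
lemma upperConj_add_self_le {l d δ ρ α a : ℝ} (hl : l ∈ Ioo (0 : ℝ) 1) (hd : d ∈ Ioo 0 (1 - l))
    (ha : a ∈ Icc (0 : ℝ) 1) (h0 : 0 ≤ upperConj l d δ ρ α 0) (h1 : a ≤ upperConj l d δ ρ α α)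
    (y : ℝ) : upperConj l d δ ρ α (y + ρ) ≤ liftF l d δ a (upperConj l d δ ρ α y) := by
  have hm := upperConj_mono hl hd δ ρ α
  have h2 : (⌊y⌋ : ℝ) ≤ ⌊upperConj l d δ ρ α y⌋ := by
    have h := upperConj_add_int hl d δ ρ α 0 ⌊y⌋
    rw [zero_add] at h
    exact_mod_cast Int.le_floor.2 (by linarith [hm (Int.floor_le y)])
  have h3 : (⌊y - α⌋ : ℝ) ≤ ⌊upperConj l d δ ρ α y - a⌋ := by
    have h := upperConj_add_int hl d δ ρ α α ⌊y - α⌋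
    have h' : α + ⌊y - α⌋ ≤ y := by linarith [Int.floor_le (y - α)]
    exact_mod_cast Int.le_floor.2 (by linarith [hm h'])
  rw [upperConj_add_self hl, liftF_eq l d δ ha]
  have h4 := mul_le_mul_of_nonneg_left h2 (sub_nonneg.2 hd.2.le)
  have h5 := mul_le_mul_of_nonneg_left h3 hd.1.le
  linarith

/-- If `φ⁻` is small enough at `0` and at `α`, then points below `φ⁻(y)` are mapped below
`φ⁻(y + ρ)`. Strict inequalities are needed since `F` is right-continuous while `φ⁻` is
left-continuous. -/
lemma liftF_lt_lowerConj_add_self {l d δ ρ α a : ℝ} (hl : l ∈ Ioo (0 : ℝ) 1)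
    (hd : d ∈ Ioo 0 (1 - l)) (ha : a ∈ Icc (0 : ℝ) 1) (h0 : lowerConj l d δ ρ α 0 ≤ 0)
    (h1 : lowerConj l d δ ρ α α ≤ a) {x y : ℝ} (hx : x < lowerConj l d δ ρ α y) :
    liftF l d δ a x < lowerConj l d δ ρ α (y + ρ) := by
  have hm := lowerConj_mono hl hd δ ρ α
  have h2 : (⌊x⌋ : ℝ) ≤ ⌈y⌉ - 1 := by
    have h := lowerConj_add_int hl d δ ρ α 0 ⌈y⌉
    rw [zero_add] at h
    have h' : ⌊x⌋ < ⌈y⌉ := Int.floor_lt.2 (by linarith [hm (Int.le_ceil y)])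
    exact_mod_cast Int.le_sub_one_of_lt h'
  have h3 : (⌊x - a⌋ : ℝ) ≤ ⌈y - α⌉ - 1 := by
    have h := lowerConj_add_int hl d δ ρ α α ⌈y - α⌉
    have h4 : y ≤ α + ⌈y - α⌉ := by linarith [Int.le_ceil (y - α)]
    have h' : ⌊x - a⌋ < ⌈y - α⌉ := Int.floor_lt.2 (by linarith [hm h4])
    exact_mod_cast Int.le_sub_one_of_lt h'
  rw [lowerConj_add_self hl, liftF_eq l d δ ha]
  have h4 := mul_le_mul_of_nonneg_left h2 (sub_nonneg.2 hd.2.le)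
  have h5 := mul_le_mul_of_nonneg_left h3 hd.1.le
  have h6 := mul_lt_mul_of_pos_left hx hl.1
  linarith

lemma le_translationNumber_of_upperConj {l d δ ρ α a : ℝ} (hl : l ∈ Ioo (0 : ℝ) 1)
    (hd : d ∈ Ioo 0 (1 - l)) (ha : a ∈ Icc (0 : ℝ) 1) (h0 : 0 ≤ upperConj l d δ ρ α 0)
    (h1 : a ≤ upperConj l d δ ρ α α) : ρ ≤ (liftMap hl hd δ a).translationNumber := by
  have hm := upperConj_mono hl hd δ ρ α
  have h : ∀ n : ℕ, upperConj l d δ ρ α (n * ρ) ≤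
      (liftMap hl hd δ a)^[n] (upperConj l d δ ρ α 0) := by
    intro n
    induction n with
    | zero => simp
    | succ n ih =>
      rw [Function.iterate_succ_apply', show ((n + 1 : ℕ) : ℝ) * ρ = n * ρ + ρ by push_cast; ring]
      exact (upperConj_add_self_le hl hd ha h0 h1 _).trans ((liftMap hl hd δ a).monotone ih)
  refine le_translationNumber_of_le_iterate _ (x := upperConj l d δ ρ α 0)
    (C := upperConj l d δ ρ α 0 - 1) fun n => ?_
  have h2 := upperConj_add_int hl d δ ρ α 0 ⌊n * ρ⌋
  rw [zero_add] at h2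
  linarith [h n, hm (Int.floor_le (n * ρ)), Int.lt_floor_add_one (n * ρ)]

lemma translationNumber_le_of_lowerConj {l d δ ρ α a : ℝ} (hl : l ∈ Ioo (0 : ℝ) 1)
    (hd : d ∈ Ioo 0 (1 - l)) (ha : a ∈ Icc (0 : ℝ) 1) (h0 : lowerConj l d δ ρ α 0 ≤ 0)
    (h1 : lowerConj l d δ ρ α α ≤ a) : (liftMap hl hd δ a).translationNumber ≤ ρ := by
  have hm := lowerConj_mono hl hd δ ρ α
  have h : ∀ n : ℕ, (liftMap hl hd δ a)^[n] (lowerConj l d δ ρ α 0 - 1) <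
      lowerConj l d δ ρ α (n * ρ) := by
    intro n
    induction n with
    | zero => simp
    | succ n ih =>
      rw [Function.iterate_succ_apply', show ((n + 1 : ℕ) : ℝ) * ρ = n * ρ + ρ by push_cast; ring]
      exact liftF_lt_lowerConj_add_self hl hd ha h0 h1 ih
  -- The orbit starts at `φ⁻(0) - 1`, strictly below `φ⁻(0)`.
  refine translationNumber_le_of_iterate_le _ (x := lowerConj l d δ ρ α 0 - 1)
    (C := lowerConj l d δ ρ α 0 + 1) fun n => ?_
  have h2 := lowerConj_add_int hl d δ ρ α 0 ⌈n * ρ⌉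
  rw [zero_add] at h2
  linarith [h n, hm (Int.le_ceil (n * ρ)), Int.ceil_lt_add_one (n * ρ)]

/-- Strictness comes from room in the rotation number: `lowerConj` for `r < ρ` tends to `upperConj`
for `ρ`, so the hypotheses of `translationNumber_le_of_lowerConj` hold for some `r < ρ`. -/
lemma translationNumber_lt_of_upperConj {l d δ ρ α a : ℝ} (hl : l ∈ Ioo (0 : ℝ) 1)
    (hd : d ∈ Ioo 0 (1 - l)) (ha : a ∈ Icc (0 : ℝ) 1) (h0 : upperConj l d δ ρ α 0 < 0)
    (h1 : upperConj l d δ ρ α α < a) : (liftMap hl hd δ a).translationNumber < ρ := by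
  obtain ⟨r, ⟨hr0, hr1⟩, hr⟩ :=
    ((((tendsto_lowerConj_left hl d δ ρ α 0).eventually_lt_const h0).and
      ((tendsto_lowerConj_left hl d δ ρ α α).eventually_lt_const h1)).and
      self_mem_nhdsWithin).exists
  exact (translationNumber_le_of_lowerConj hl hd ha hr0.le hr1.le).trans_lt hr

/-- The mirror image of `translationNumber_lt_of_upperConj`: the bound holds for some `r > ρ`. -/
lemma lt_translationNumber_of_lowerConj {l d δ ρ α a : ℝ} (hl : l ∈ Ioo (0 : ℝ) 1)
    (hd : d ∈ Ioo 0 (1 - l)) (ha : a ∈ Icc (0 : ℝ) 1) (h0 : 0 < lowerConj l d δ ρ α 0)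
    (h1 : a < lowerConj l d δ ρ α α) : ρ < (liftMap hl hd δ a).translationNumber := by
  obtain ⟨r, ⟨hr0, hr1⟩, hr⟩ :=
    ((((tendsto_upperConj_right hl d δ ρ α 0).eventually_const_lt h0).and
      ((tendsto_upperConj_right hl d δ ρ α α).eventually_const_lt h1)).and
      self_mem_nhdsWithin).exists
  exact lt_of_lt_of_le hr (le_translationNumber_of_upperConj hl hd ha hr0.le hr1.le)

/-! ### The translation number lies in the open unit interval -/

/-- Outside `F1` the displacement `F(x) - x` is bounded below by a positive constant. On each of the
two branches it decreases in `x`, so its infimum is the left limit at `a` or at `1`. -/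
lemma translationNumber_pos {l d δ a : ℝ} (hl : l ∈ Ioo (0 : ℝ) 1) (hd : d ∈ Ioo 0 (1 - l))
    (hδ : δ ∈ Ioo (1 - l - d) 1) (ha : a ∈ Icc (0 : ℝ) 1) (hF : (δ, a) ∉ F1 l d) :
    0 < (liftMap hl hd δ a).translationNumber := by
  have hl1 : 0 < 1 - l := sub_pos.2 hl.2
  have hpos : 0 < δ - (1 - l) * a := by
    rcases le_or_gt δ (1 - l) with h | h
    · have h1 : a < δ / (1 - l) := by
        by_contra h2
        exact hF ⟨⟨hδ.1, h⟩, not_lt.1 h2, ha.2⟩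
      rw [lt_div_iff₀ hl1] at h1
      linarith
    · nlinarith [ha.2]
  have hpos' : 0 < δ + d - (1 - l) := by linarith [hδ.1]
  refine (lt_min hpos hpos').trans_le (CircleDeg1Lift.le_translationNumber_of_add_le _ fun x => ?_)
  rw [coe_liftMap, liftF]
  have hx := Int.floor_add_fract x
  have h1 := Int.fract_lt_one x
  unfold theta
  split_ifs with h
  · have := min_le_left (δ - (1 - l) * a) (δ + d - (1 - l))
    nlinarith
  · have := min_le_right (δ - (1 - l) * a) (δ + d - (1 - l))
    nlinarith

/-- Outside `F2` the displacement `F(x) - x` is bounded above by a constant less than `1`. Its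
supremum is its value at `0` or at `a`. -/
lemma translationNumber_lt_one {l d δ a : ℝ} (hl : l ∈ Ioo (0 : ℝ) 1) (hd : d ∈ Ioo 0 (1 - l))
    (hδ : δ ∈ Ioo (1 - l - d) 1) (ha : a ∈ Icc (0 : ℝ) 1) (hF : (δ, a) ∉ F2 l d) :
    (liftMap hl hd δ a).translationNumber < 1 := by
  have hl1 : 0 < 1 - l := sub_pos.2 hl.2
  have hpos : δ + d - (1 - l) * a < 1 := by
    rcases le_or_gt (1 - d) δ with h | h
    · have h1 : (δ + d - 1) / (1 - l) < a := by
        by_contra h2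
        exact hF ⟨⟨h, hδ.2⟩, ha.1, not_lt.1 h2⟩
      rw [div_lt_iff₀ hl1] at h1
      linarith
    · nlinarith [ha.1]
  refine (CircleDeg1Lift.translationNumber_le_of_le_add _ fun x => ?_).trans_lt
    (max_lt hδ.2 hpos)
  rw [coe_liftMap, liftF]
  have hx := Int.floor_add_fract x
  have h1 := Int.fract_nonneg x
  unfold theta
  split_ifs with h
  · have := le_max_left δ (δ + d - (1 - l) * a)
    nlinarith
  · have := le_max_right δ (δ + d - (1 - l) * a)
    nlinarith

/-! ### Existence of the intercept -/

/-- If no `α ∈ [0, 1]` works, each `α` violates a condition that fails for too large `α` (`0 ≤ φ(0)`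
or `φ⁻(α) ≤ a`) or one that fails for too small `α` (`φ⁻(0) ≤ 0` or `a ≤ φ(α)`). The two kinds of
`α` form disjoint open sets, since `ρ` is the translation number, and neither can be all of
`[0, 1]`. -/
lemma exists_conj {l d δ a : ℝ} (hl : l ∈ Ioo (0 : ℝ) 1) (hd : d ∈ Ioo 0 (1 - l))
    (ha : a ∈ Icc (0 : ℝ) 1) {ρ : ℝ} (hρ : (liftMap hl hd δ a).translationNumber = ρ) :
    ∃ α ∈ Icc (0 : ℝ) 1, (0 ≤ upperConj l d δ ρ α 0 ∧ lowerConj l d δ ρ α 0 ≤ 0) ∧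
      (lowerConj l d δ ρ α α ≤ a ∧ a ≤ upperConj l d δ ρ α α) := by
  have hc : 0 < 1 - l - d := sub_pos.2 hd.2
  have hle := lowerConj_le_upperConj hl hd δ ρ
  have hPQ : ∀ α, ¬ (upperConj l d δ ρ α 0 < 0 ∧ upperConj l d δ ρ α α < a) := fun α h =>
    (translationNumber_lt_of_upperConj hl hd ha h.1 h.2).ne hρ
  have hPQ' : ∀ α, ¬ (0 < lowerConj l d δ ρ α 0 ∧ a < lowerConj l d δ ρ α α) := fun α h =>
    (lt_translationNumber_of_lowerConj hl hd ha h.1 h.2).ne' hρ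
  have o1 : IsOpen {α | upperConj l d δ ρ α 0 < 0} := by
    convert (isOpen_floorSum_lt hl ρ
      (-((δ + d) / (1 - l) + (1 - l - d) * floorSum l ρ 0) / d)).preimage
      (by fun_prop : Continuous fun α : ℝ => 0 - α) using 1
    ext α
    simp only [upperConj, mem_preimage, mem_ofPred_eq, lt_div_iff₀ hd.1]
    constructor <;> intro h <;> linarith
  have o2 : IsOpen {α | 0 < lowerConj l d δ ρ α 0} := by
    convert (isOpen_lt_ceilSum hl ρ
      (-((δ + d) / (1 - l) + (1 - l - d) * ceilSum l ρ 0) / d)).preimage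
      (by fun_prop : Continuous fun α : ℝ => 0 - α) using 1
    ext α
    simp only [lowerConj, mem_preimage, mem_ofPred_eq, div_lt_iff₀ hd.1]
    constructor <;> intro h <;> linarith
  have o3 : IsOpen {α | upperConj l d δ ρ α α < a} := by
    convert isOpen_floorSum_lt hl ρ
      ((a - ((δ + d) / (1 - l) + d * floorSum l ρ 0)) / (1 - l - d)) using 1
    ext α
    simp only [upperConj, mem_ofPred_eq, lt_div_iff₀ hc, sub_self]
    constructor <;> intro h <;> linarith
  have o4 : IsOpen {α | a < lowerConj l d δ ρ α α} := by
    convert isOpen_lt_ceilSum hl ρ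
      ((a - ((δ + d) / (1 - l) + d * ceilSum l ρ 0)) / (1 - l - d)) using 1
    ext α
    simp only [lowerConj, mem_ofPred_eq, div_lt_iff₀ hc, sub_self]
    constructor <;> intro h <;> linarith
  by_contra! hno
  have hcov : ∀ α ∈ Icc (0 : ℝ) 1,
      (upperConj l d δ ρ α 0 < 0 ∨ a < lowerConj l d δ ρ α α) ∨
      (0 < lowerConj l d δ ρ α 0 ∨ upperConj l d δ ρ α α < a) := by
    intro α hα
    by_contra! h
    exact absurd (hno α hα ⟨h.1.1, h.2.1⟩ h.1.2) (not_lt.2 h.2.2)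
  -- At `α = 0` the two levels `φ(0)` and `φ(α)` coincide.
  have hzero : 0 < lowerConj l d δ ρ 0 0 ∨ upperConj l d δ ρ 0 0 < a := by
    refine (hcov 0 (left_mem_Icc.2 zero_le_one)).resolve_left ?_
    rintro (h | h)
    · exact hPQ 0 ⟨h, h.trans_le ha.1⟩
    · exact hPQ' 0 ⟨ha.1.trans_lt h, h⟩
  -- At `α = 1` they differ by exactly `1`.
  have hone : upperConj l d δ ρ 1 0 < 0 ∨ a < lowerConj l d δ ρ 1 1 := by
    have hu := upperConj_add_int hl d δ ρ 1 0 1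
    have hv := lowerConj_add_int hl d δ ρ 1 0 1
    simp only [Int.cast_one, zero_add] at hu hv
    refine (hcov 1 (right_mem_Icc.2 zero_le_one)).resolve_right ?_
    rintro (h | h)
    · exact hPQ' 1 ⟨h, by linarith [ha.2]⟩
    · exact hPQ 1 ⟨by linarith [ha.2], h⟩
  obtain ⟨α, -, h1, h2⟩ := isPreconnected_Icc (a := (0 : ℝ)) (b := 1) _ _ (o1.union o4)
    (o2.union o3) hcov ⟨1, right_mem_Icc.2 zero_le_one, hone⟩
    ⟨0, left_mem_Icc.2 zero_le_one, hzero⟩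
  rcases h1 with h1 | h1 <;> rcases h2 with h2 | h2
  · exact absurd (h1.trans h2) (not_lt.2 (hle α 0))
  · exact hPQ α ⟨h1, h2⟩
  · exact hPQ' α ⟨h2, h1⟩
  · exact absurd (h2.trans h1) (not_lt.2 (hle α α))

/-! ### Location of the intercept -/

/-- If `α + ρ` exceeds `1`, then `φ⁻(α + ρ) ≥ φ(1) ≥ 1`, whereas `φ⁻(α + ρ) = l φ⁻(α) + δ`. -/
lemma one_le_of_one_sub_lt {l d δ ρ α a : ℝ} (hl : l ∈ Ioo (0 : ℝ) 1) (hd : d ∈ Ioo 0 (1 - l))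
    (hα : α ∈ Icc (0 : ℝ) 1) (hρ : ρ < 1) (h0 : 0 ≤ upperConj l d δ ρ α 0)
    (h1 : lowerConj l d δ ρ α α ≤ a) (h : 1 - ρ < α) :
    1 ≤ l * a + δ ∧ (Irrational ρ → 1 < l * a + δ) := by
  have hu := upperConj_add_int hl d δ ρ α 0 1
  simp only [Int.cast_one, zero_add] at hu
  have hc : ⌈α⌉ = 1 := by
    rw [Int.ceil_eq_iff]; push_cast; constructor <;> linarith [hα.2]
  have hv : lowerConj l d δ ρ α (α + ρ) = l * lowerConj l d δ ρ α α + δ := by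
    rw [lowerConj_add_self hl, hc, sub_self, Int.ceil_zero]; push_cast; ring
  have hw := mul_le_mul_of_nonneg_left h1 hl.1.le
  have hlt : 1 < α + ρ := by linarith
  exact ⟨by linarith [upperConj_le_lowerConj hl hd δ ρ α hlt],
    fun hi => by linarith [upperConj_lt_lowerConj hl hd δ hi α hlt]⟩

/-- If `α + ρ` is below `1`, then `φ(α + ρ) ≤ φ⁻(1) ≤ 1`, whereas `φ(α + ρ) = l φ(α) + δ + d`. -/
lemma le_one_of_lt_one_sub {l d δ ρ α a : ℝ} (hl : l ∈ Ioo (0 : ℝ) 1) (hd : d ∈ Ioo 0 (1 - l))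
    (hα : α ∈ Icc (0 : ℝ) 1) (hρ : 0 < ρ) (h0 : lowerConj l d δ ρ α 0 ≤ 0)
    (h1 : a ≤ upperConj l d δ ρ α α) (h : α < 1 - ρ) :
    l * a + δ + d ≤ 1 ∧ (Irrational ρ → l * a + δ + d < 1) := by
  have hu := lowerConj_add_int hl d δ ρ α 0 1
  simp only [Int.cast_one, zero_add] at hu
  have hc : ⌊α⌋ = 0 := by
    rw [Int.floor_eq_iff]; push_cast; constructor <;> linarith [hα.1]
  have hv : upperConj l d δ ρ α (α + ρ) = l * upperConj l d δ ρ α α + (δ + d) := by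
    rw [upperConj_add_self hl, hc, sub_self, Int.floor_zero]; push_cast; ring
  have hw := mul_le_mul_of_nonneg_left h1 hl.1.le
  have hlt : α + ρ < 1 := by linarith
  exact ⟨by linarith [upperConj_le_lowerConj hl hd δ ρ α hlt],
    fun hi => by linarith [upperConj_lt_lowerConj hl hd δ hi α hlt]⟩

end PiecewiseContraction

open PiecewiseContraction
theorem theorem3 (l d δ a : ℝ) (hl : l ∈ Set.Ioo (0 : ℝ) 1) (hd : d ∈ Set.Ioo 0 (1 - l))
    (hδ : δ ∈ Set.Ioo (1 - l - d) 1) (ha : a ∈ Set.Icc (0 : ℝ) 1)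
    (hF : (δ, a) ∉ F1 l d ∪ F2 l d) :
    ∃ ρf ∈ Set.Ioo (0 : ℝ) 1,
      IsRotationNumber (liftF l d δ a) ρf ∧
      (∃ α ∈ Set.Icc (0 : ℝ) 1, IntervalCond l d ρf α δ a) ∧
      (∀ ρ ∈ Set.Ioo (0 : ℝ) 1, ∀ α ∈ Set.Icc (0 : ℝ) 1, IntervalCond l d ρ α δ a →
        ρ = ρf ∧
        ((δ, a) ∈ M1 l d → α ∈ Set.Icc 0 (1 - ρf)) ∧
        ((δ, a) ∈ M3 l → α ∈ Set.Icc (1 - ρf) 1) ∧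
        ((δ, a) ∈ M2 l d → (Irrational ρf ∨ a ∉ ({eta1 l d δ, eta2 l δ} : Set ℝ)) →
          α = 1 - ρf)) := by
  have hF1 : (δ, a) ∉ F1 l d := fun h => hF (Or.inl h)
  have hF2 : (δ, a) ∉ F2 l d := fun h => hF (Or.inr h)
  have hτ0 := translationNumber_pos hl hd hδ ha hF1
  have hτ1 := translationNumber_lt_one hl hd hδ ha hF2
  refine ⟨(liftMap hl hd δ a).translationNumber, ⟨hτ0, hτ1⟩,
    ⟨_, tendsto_iterate_div (liftMap hl hd δ a), (Int.fract_eq_self.2 ⟨hτ0.le, hτ1⟩).symm⟩, ?_, ?_⟩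
  · obtain ⟨α, hα, h⟩ := exists_conj hl hd ha rfl
    exact ⟨α, hα, (intervalCond_iff hl d δ _ a hα).2 h⟩
  · intro ρ hρ α hα hcond
    obtain ⟨⟨hu0, hl0⟩, hla, hua⟩ := (intervalCond_iff hl d δ ρ a hα).1 hcond
    have heq : ρ = (liftMap hl hd δ a).translationNumber :=
      le_antisymm (le_translationNumber_of_upperConj hl hd ha hu0 hua)
        (translationNumber_le_of_lowerConj hl hd ha hl0 hla)
    rw [← heq]
    have hgt := one_le_of_one_sub_lt hl hd hα hρ.2 hu0 hla
    have hlt := le_one_of_lt_one_sub hl hd hα hρ.1 hl0 hua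
    refine ⟨rfl, ?_, ?_, ?_⟩
    · rintro ⟨-, -, h⟩
      simp only [eta1, lt_div_iff₀ hl.1] at h
      refine ⟨hα.1, not_lt.1 fun h' => ?_⟩
      linarith [(hgt h').1, hd.1]
    · rintro ⟨-, h, -⟩
      simp only [eta2, div_lt_iff₀ hl.1] at h
      refine ⟨not_lt.1 fun h' => ?_, hα.2⟩
      linarith [(hlt h').1, hd.1]
    · rintro ⟨-, -, h1, h2⟩ h
      simp only [eta1, eta2, div_le_iff₀ hl.1, le_div_iff₀ hl.1] at h1 h2
      simp only [eta1, eta2, mem_insert_iff, mem_singleton_iff, not_or, eq_div_iff hl.1.ne'] at h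
      rcases lt_trichotomy α (1 - ρ) with h' | h' | h'
      · rcases h with h | h
        · linarith [(hlt h').2 h]
        · exact absurd (by linarith [(hlt h').1]) h.1
      · exact h'
      · rcases h with h | h
        · linarith [(hgt h').2 h]
        · exact absurd (by linarith [(hgt h').1]) h.2
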